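/- Let $\lambda_k>0$ $(k\ge 0)$, $\mu_0=0$, $\mu_k>0$ $(k\ge 1)$, put $\pi_0=1$, $\pi_k=\frac{\lambda_0\cdots\lambda_{k-1}}{\mu_1\cdots\mu_k}$ for $k\ge1$, and assume the ergodicity conditions $\pi:=\sum_k\pi_k<\infty$ and $\sum_k \frac{1}{\lambda_k\pi_k}=\infty$; let $p_k=\pi_k/\pi$. Let $X=\{X(t),t\ge0\}$ be a strictly stationary birth–death process on $\{0,1,2,\dots\}$ with birth rates $\lambda_k$, death rates $\mu_k$ and stationary marginal distribution $P=(p_k)$: that is, $X$ has almost surely càdlàg paths and is a time-homogeneous Markov process whose transition probabilities $P_{i,j}(t)$ satisfy $P_{i,j}(0)=\delta_{ij}$ and, as $h\downarrow0$, $$P_{k,k+1}(h)=\lambda_kh+o(h;k),\qquad P_{k,k-1}(h)=\mu_kh+o(h;k)\ (k\ge1),\qquad P_{k,k}(h)=1-(\lambda_k+\mu_k)h+o(h;k),$$ where the error terms may depend on the state $k$. Suppose that for some $\delta>0$ the error terms satisfy $o(h;k)=k^\delta\,o(h;1)$ for $k=1,2,3,\dots$, in the sense that there is a function $r(h)=o(h)$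 such that, for all sufficiently small $h>0$ and all $k\ge1$, the three error terms at state $k$ are at most $k^\delta r(h)$ in absolute value. Let $q\in\mathbb R$ and suppose that, with the same $\delta$, $$S_q:=\sum_{k=0}^\infty\pi_k\bigl(e^{qk}(\lambda_k+\mu_k)+k^\delta\bigr)<\infty .$$ Let $c\in\mathbb R$ and $g(x)=e^{q(x-c)}$. Then, for any $b>1$, $$\sum_{n=0}^\infty E^P\Bigl(\max_{s\in[0,b^{-n}]}|g(X(s))-g(X(0))|\Bigr)<\infty,$$ where $E^P$ denotes expectation for the process started from the distribution $P$. (In particular, for each $n$ the maximum exists almost surely and is integrable.) -/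

import Mathlib

open MeasureTheory ProbabilityTheory Filter Topology Asymptotics Set
open scoped NNReal ENNReal

/-- The potential coefficients `π₀ = 1`, `π_k = (λ₀ ⋯ λ_{k-1}) / (μ₁ ⋯ μ_k)`. -/
noncomputable def potentialCoeff (lam mu : ℕ → ℝ) (k : ℕ) : ℝ :=
  ∏ i ∈ Finset.range k, lam i / mu (i + 1)

/-- The stationary probabilities `p_k = π_k / ∑ⱼ π_j`. -/
noncomputable def stationaryProb (lam mu : ℕ → ℝ) (k : ℕ) : ℝ :=
  potentialCoeff lam mu k / ∑' j, potentialCoeff lam mu j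

/-- Admissible birth rates `lam` and death rates `mu` on `{0, 1, 2, …}` with reflection at `0`. -/
structure IsBirthDeathRates (lam mu : ℕ → ℝ) : Prop where
  birth_pos : ∀ k, 0 < lam k
  death_zero : mu 0 = 0
  death_pos : ∀ k, 1 ≤ k → 0 < mu k

/-- The ergodicity condition: `∑ π_k < ∞` and `∑ 1 / (λ_k π_k) = ∞` (series with positive terms). -/
structure IsErgodicRates (lam mu : ℕ → ℝ) : Prop where
  summable_potential : Summable (potentialCoeff lam mu)
  not_summable_recip : ¬ Summable (fun k => 1 / (lam k * potentialCoeff lam mu k))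

/-- `P t i j` is a (standard, honest) transition function on `{0, 1, 2, …}` with the infinitesimal
behaviour of the birth–death process with rates `lam`, `mu`. The `o(h)` may depend on the state.
(As `mu 0 = 0`, there is no downward transition from `0`.) -/
structure IsBirthDeathTransition (lam mu : ℕ → ℝ) (P : ℝ≥0 → ℕ → ℕ → ℝ) : Prop where
  nonneg : ∀ t i j, 0 ≤ P t i j
  hasSum_one : ∀ t i, HasSum (fun j => P t i j) 1
  zero : ∀ i j, P 0 i j = if i = j then 1 else 0
  chapman_kolmogorov : ∀ s t i j, HasSum (fun k => P s i k * P t k j) (P (s + t) i j)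
  birth : ∀ i, (fun h : ℝ≥0 => P h i (i + 1) - lam i * h) =o[𝓝[>] 0] (fun h : ℝ≥0 => (h : ℝ))
  death : ∀ i, 1 ≤ i →
    (fun h : ℝ≥0 => P h i (i - 1) - mu i * h) =o[𝓝[>] 0] (fun h : ℝ≥0 => (h : ℝ))
  stay : ∀ i, (fun h : ℝ≥0 => P h i i - (1 - (lam i + mu i) * h)) =o[𝓝[>] 0]
    (fun h : ℝ≥0 => (h : ℝ))

/-- The condition `o(h; k) = k^δ o(h; 1)`, `k = 1, 2, 3, …`, on the error terms of the transition
probabilities: a single `r(h) = o(h)` bounds the three errors at state `k` by `k^δ r(h)`,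
for all `k ≥ 1` simultaneously. -/
def HasErrorGrowth (lam mu : ℕ → ℝ) (P : ℝ≥0 → ℕ → ℕ → ℝ) (δ : ℝ) : Prop :=
  ∃ r : ℝ≥0 → ℝ, r =o[𝓝[>] 0] (fun h : ℝ≥0 => (h : ℝ)) ∧
    ∀ᶠ h : ℝ≥0 in 𝓝[>] 0, ∀ k : ℕ, 1 ≤ k →
      |P h k (k + 1) - lam k * h| ≤ (k : ℝ) ^ δ * r h ∧
      |P h k (k - 1) - mu k * h| ≤ (k : ℝ) ^ δ * r h ∧
      |P h k k - (1 - (lam k + mu k) * h)| ≤ (k : ℝ) ^ δ * r h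

/-- `X` is a time-homogeneous Markov process with transition function `P`
(with respect to the filtration that it generates). -/
def IsMarkovWith {Ω : Type*} [MeasurableSpace Ω] (ν : Measure Ω) (P : ℝ≥0 → ℕ → ℕ → ℝ)
    (X : ℝ≥0 → Ω → ℕ) : Prop :=
  ∀ (s t : ℝ≥0) (i j : ℕ) (A : Set Ω),
    MeasurableSet[⨆ u : Set.Iic s, MeasurableSpace.comap (X u) inferInstance] A →
      ν.real (A ∩ {ω | X s ω = i} ∩ {ω | X (s + t) ω = j}) =
        ν.real (A ∩ {ω | X s ω = i}) * P t i j

/-- Strict stationarity: finite-dimensional distributions are invariant under time shifts. -/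
def IsStrictlyStationary {Ω : Type*} [MeasurableSpace Ω] (ν : Measure Ω)
    (X : ℝ≥0 → Ω → ℕ) : Prop :=
  ∀ (I : Finset ℝ≥0) (h : ℝ≥0),
    IdentDistrib (fun ω (t : I) => X (t + h) ω) (fun ω (t : I) => X t ω) ν ν

/-- A path in `{0, 1, 2, …}` that is right continuous with left limits. -/
def IsCadlagPath (x : ℝ≥0 → ℕ) : Prop :=
  (∀ t, ContinuousWithinAt x (Set.Ici t) t) ∧
    ∀ t, 0 < t → ∃ l : ℕ, Tendsto x (𝓝[<] t) (𝓝 l)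

/-- `X` is the stationary birth–death process with rates `lam`, `mu` and transition function `P`,
started from the stationary distribution, under the measure `ν`. -/
structure IsStationaryBirthDeathProcess {Ω : Type*} [MeasurableSpace Ω] (ν : Measure Ω)
    (lam mu : ℕ → ℝ) (P : ℝ≥0 → ℕ → ℕ → ℝ) (X : ℝ≥0 → Ω → ℕ) : Prop where
  measurable : ∀ t, Measurable (X t)
  transition : IsBirthDeathTransition lam mu P
  markov : IsMarkovWith ν P X
  initial : ∀ k, ν.real {ω | X 0 ω = k} = stationaryProb lam mu k
  stationary : IsStrictlyStationary ν X
  cadlag : ∀ᵐ ω ∂ν, IsCadlagPath (fun t => X t ω)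

/-- The increments `|g (X s) - g (X 0)|`, `s ∈ [0, T]`, along the path of `ω`. -/
def incrementSet {Ω : Type*} (X : ℝ≥0 → Ω → ℕ) (g : ℝ → ℝ) (T : ℝ) (ω : Ω) : Set ℝ :=
  (fun s : ℝ≥0 => |g (X s ω) - g (X 0 ω)|) '' {s : ℝ≥0 | (s : ℝ) ≤ T}

/-- The maximal increment `max_{s ∈ [0, T]} |g (X s) - g (X 0)|`, as a supremum. -/
noncomputable def maxIncrement {Ω : Type*} (X : ℝ≥0 → Ω → ℕ) (g : ℝ → ℝ) (T : ℝ) (ω : Ω) : ℝ :=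
  sSup (incrementSet X g T ω)

/-!
The maximal increment of `g ∘ X` over `[0, T]` is dominated by the variation of `g ∘ X`, and the
expected variation of the stationary process is `T` times the stationary rate
`∑ₖ pₖ (λₖ |g (k + 1) - g k| + μₖ |g (k - 1) - g k|)`. For `g x = exp (q (x - c))` this rate is at
most a constant multiple of `∑ₖ πₖ exp (q k) (λₖ + μₖ)` (`exists_variationRate_le`), so the
expectations over `[0, b ^ (-n)]` are bounded by a geometric sequence.

The bound on the expectation avoids jump times. A càdlàg path with values in `ℕ` takes finitely many
values on `[0, T]` (`IsCadlagPath.finite_image`), and each of them is seen on all sufficiently fine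
equidistant grids (`eventually_exists_grid_eq`). This makes the supremum a maximum and an eventually
constant limit of grid maxima, hence measurable. It also bounds it by the limit inferior of the
variations along the grids, where for a large level `M` only steps between states below `M` need to
be counted (`maxIncrement_le_iSup_liminf`). By stationarity and the Markov property, the expected
truncated variation is a finite sum of transition probabilities over the mesh. The probability of
a jump of size at least two is `o(h)` at each state, as the transition probabilities to `k` and to
its neighbours already add up to `1 + o(h)`; so as the mesh tends to `0` the limit is `T` times the
truncated rate (`IsStationaryBirthDeathProcess.tendsto_integral_gridVariation`). Fatou's lemma in
the mesh, and then monotone convergence in `M`, give the bound.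
-/

/-! ### Infinitesimal behaviour of the transition function -/

/-- The off-diagonal entries of the generator of the birth–death process: the rate of jumping from
`k` to `j`. The diagonal is set to `0`. -/
def jumpRate (lam mu : ℕ → ℝ) (k j : ℕ) : ℝ :=
  if j = k + 1 then lam k else if j + 1 = k then mu k else 0

lemma tendsto_div_of_isLittleO_sub_mul {u : ℝ≥0 → ℝ} {a : ℝ}
    (hu : (fun h : ℝ≥0 => u h - a * h) =o[𝓝[>] 0] (fun h : ℝ≥0 => (h : ℝ))) :
    Tendsto (fun h : ℝ≥0 => u h / h) (𝓝[>] 0) (𝓝 a) := by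
  have h1 := hu.tendsto_div_nhds_zero.add_const a
  rw [zero_add] at h1
  refine h1.congr' ?_
  filter_upwards [self_mem_nhdsWithin] with h hh
  have : (h : ℝ) ≠ 0 := by exact_mod_cast (ne_of_gt hh)
  field_simp
  ring

/-- The three expansions in the definition of a birth–death process add up to total mass
`1 + o(h)`, so jumps of size at least two have probability `o(h)`. -/
lemma IsBirthDeathTransition.tendsto_div {lam mu : ℕ → ℝ} {P : ℝ≥0 → ℕ → ℕ → ℝ}
    (hmu : mu 0 = 0) (hP : IsBirthDeathTransition lam mu P) {k j : ℕ} (hkj : k ≠ j) :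
    Tendsto (fun h : ℝ≥0 => P h k j / h) (𝓝[>] 0) (𝓝 (jumpRate lam mu k j)) := by
  unfold jumpRate
  split_ifs with h1 h2
  · subst h1
    exact tendsto_div_of_isLittleO_sub_mul (hP.birth k)
  · subst h2
    simpa using tendsto_div_of_isLittleO_sub_mul (hP.death (j + 1) (by omega))
  · have hsum : ∀ (h : ℝ≥0) (s : Finset ℕ), ∑ i ∈ s, P h k i ≤ 1 := fun h s =>
      sum_le_hasSum s (fun i _ => hP.nonneg h k i) (hP.hasSum_one h k)
    rcases Nat.eq_zero_or_pos k with rfl | hk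
    · have ho := ((hP.birth 0).add (hP.stay 0)).neg_left
      have h0 : (fun h : ℝ≥0 => (1 - P h 0 0 - P h 0 1) - 0 * h) =o[𝓝[>] 0]
          (fun h : ℝ≥0 => (h : ℝ)) := by
        refine ho.congr_left fun h => ?_
        simp only [hmu]
        ring
      refine squeeze_zero (fun h => div_nonneg (hP.nonneg _ _ _) h.2) (fun h => ?_)
        (tendsto_div_of_isLittleO_sub_mul h0)
      have := hsum h {0, 1, j}
      rw [Finset.sum_insert (by simp; omega), Finset.sum_insert (by simp; omega),
        Finset.sum_singleton] at this
      exact div_le_div_of_nonneg_right (by linarith) h.2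
    · have ho := (((hP.birth k).add (hP.death k hk)).add (hP.stay k)).neg_left
      have h0 : (fun h : ℝ≥0 => (1 - P h k k - P h k (k + 1) - P h k (k - 1)) - 0 * h) =o[𝓝[>] 0]
          (fun h : ℝ≥0 => (h : ℝ)) := by
        refine ho.congr_left fun h => ?_
        ring
      refine squeeze_zero (fun h => div_nonneg (hP.nonneg _ _ _) h.2) (fun h => ?_)
        (tendsto_div_of_isLittleO_sub_mul h0)
      have := hsum h {k, k + 1, k - 1, j}
      rw [Finset.sum_insert (by simp; omega), Finset.sum_insert (by simp; omega),
        Finset.sum_insert (by simp; omega), Finset.sum_singleton] at this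
      exact div_le_div_of_nonneg_right (by linarith) h.2

/-! ### Càdlàg paths and grids -/

lemma eventually_eq_of_tendsto_nat {α : Type*} {l : Filter α} {u : α → ℕ} {a : ℕ}
    (hu : Tendsto u l (𝓝 a)) : ∀ᶠ x in l, u x = a := by
  rwa [nhds_discrete, tendsto_pure] at hu

/-- Around each time there are at most two values, the left limit and the value at that time;
compactness does the rest. -/
lemma IsCadlagPath.finite_image {x : ℝ≥0 → ℕ} (hx : IsCadlagPath x) {K : Set ℝ≥0}
    (hK : IsCompact K) : (x '' K).Finite := by
  refine hK.induction_on (p := fun s => (x '' s).Finite) (by simp)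
    (fun s t hst ht => ht.subset (image_mono hst))
    (fun s t hs ht => by rw [image_union]; exact hs.union ht) fun t _ => ?_
  have hr : ∀ᶠ u in 𝓝[≥] t, x u = x t := eventually_eq_of_tendsto_nat (hx.1 t)
  have hl : ∃ l, ∀ᶠ u in 𝓝[<] t, x u = l := by
    rcases eq_zero_or_pos t with rfl | ht
    · exact ⟨0, by simp⟩
    · obtain ⟨l, hl⟩ := hx.2 t ht
      exact ⟨l, eventually_eq_of_tendsto_nat hl⟩
  obtain ⟨l, hl⟩ := hl
  refine ⟨{u | x u = l ∨ x u = x t}, mem_nhdsWithin_of_mem_nhds ?_, ?_⟩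
  · rw [← nhdsLT_sup_nhdsGE]
    exact ⟨hl.mono fun u hu => Or.inl hu, hr.mono fun u hu => Or.inr hu⟩
  · refine (Set.toFinite {l, x t}).subset ?_
    rintro _ ⟨u, hu, rfl⟩
    exact hu

/-- Every value of a right continuous path on `[0, T]` is eventually seen on the grid of mesh
`T / (N + 1)`, namely at the first grid point to the right. -/
lemma eventually_exists_grid_eq {x : ℝ≥0 → ℕ} {s T : ℝ≥0} (hT : 0 < T) (hs : s ≤ T)
    (hx : ContinuousWithinAt x (Set.Ici s) s) :
    ∀ᶠ N : ℕ in atTop, ∃ i ≤ N + 1, x (i * (T / (N + 1 : ℕ))) = x s := by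
  have hh : ∀ N : ℕ, 0 < T / (N + 1 : ℕ) := fun N => by positivity
  have hlim : Tendsto (fun N : ℕ => T / ((N + 1 : ℕ) : ℝ≥0)) atTop (𝓝 0) :=
    (tendsto_const_div_atTop_nhds_zero_nat T).comp (tendsto_add_atTop_nat 1)
  have hlow : ∀ N : ℕ, s ≤ ⌈s / (T / (N + 1 : ℕ))⌉₊ * (T / (N + 1 : ℕ)) := fun N => by
    rw [← div_le_iff₀ (hh N)]
    exact Nat.le_ceil _
  have hup : ∀ N : ℕ, ⌈s / (T / (N + 1 : ℕ))⌉₊ * (T / (N + 1 : ℕ)) ≤ s + T / (N + 1 : ℕ) := by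
    intro N
    calc ⌈s / (T / (N + 1 : ℕ))⌉₊ * (T / (N + 1 : ℕ))
        ≤ (s / (T / (N + 1 : ℕ)) + 1) * (T / (N + 1 : ℕ)) :=
          mul_le_mul_left (Nat.ceil_lt_add_one zero_le).le _
      _ = s + T / (N + 1 : ℕ) := by
          rw [add_mul, div_mul_cancel₀ _ (hh N).ne', one_mul]
  have ht : Tendsto (fun N : ℕ => ⌈s / (T / (N + 1 : ℕ))⌉₊ * (T / (N + 1 : ℕ))) atTop
      (𝓝[≥] s) := by
    refine tendsto_nhdsWithin_iff.2 ⟨?_, Eventually.of_forall hlow⟩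
    refine tendsto_of_tendsto_of_tendsto_of_le_of_le tendsto_const_nhds ?_ hlow hup
    simpa using hlim.const_add s
  have hev : ∀ᶠ u in 𝓝[≥] s, x u = x s := eventually_eq_of_tendsto_nat hx
  filter_upwards [ht.eventually hev] with N hN
  refine ⟨_, Nat.ceil_le.2 ?_, hN⟩
  rw [div_le_iff₀ (hh N), mul_div_cancel₀]
  · exact hs
  · positivity

/-- The increment of `f` between two states below the level `M`, and `0` for other states. -/
noncomputable def truncIncrement (f : ℕ → ℝ) (M k j : ℕ) : ℝ :=
  if k < M ∧ j < M then |f j - f k| else 0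

/-- The variation of `f ∘ x` along the grid of mesh `T / (N + 1)` in `[0, T]`, where only the steps
between states below `M` are counted. -/
noncomputable def gridVariation (f : ℕ → ℝ) (T : ℝ≥0) (M N : ℕ) (x : ℝ≥0 → ℕ) : ℝ :=
  ∑ i ∈ Finset.range (N + 1),
    truncIncrement f M (x (i * (T / (N + 1 : ℕ)))) (x (i * (T / (N + 1 : ℕ)) + T / (N + 1 : ℕ)))

lemma truncIncrement_nonneg (f : ℕ → ℝ) (M k j : ℕ) : 0 ≤ truncIncrement f M k j := by
  unfold truncIncrement
  split_ifs <;> positivity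

lemma truncIncrement_mono (f : ℕ → ℝ) (k j : ℕ) : Monotone fun M => truncIncrement f M k j := by
  intro M M' h
  by_cases hM : k < M ∧ j < M
  · have hM' : k < M' ∧ j < M' := ⟨hM.1.trans_le h, hM.2.trans_le h⟩
    simp [truncIncrement, hM, hM']
  · simpa [truncIncrement, hM] using truncIncrement_nonneg f M' k j

lemma gridVariation_nonneg (f : ℕ → ℝ) (T : ℝ≥0) (M N : ℕ) (x : ℝ≥0 → ℕ) :
    0 ≤ gridVariation f T M N x :=
  Finset.sum_nonneg fun _ _ => truncIncrement_nonneg _ _ _ _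

lemma gridVariation_mono (f : ℕ → ℝ) (T : ℝ≥0) (N : ℕ) (x : ℝ≥0 → ℕ) :
    Monotone fun M => gridVariation f T M N x := fun _ _ h =>
  Finset.sum_le_sum fun _ _ => truncIncrement_mono _ _ _ h

lemma grid_le {T : ℝ≥0} {N i : ℕ} (hi : i ≤ N + 1) : i * (T / (N + 1 : ℕ)) ≤ T := by
  have : (0 : ℝ≥0) < (N + 1 : ℕ) := by positivity
  rw [← mul_div_assoc, div_le_iff₀ this, mul_comm]
  gcongr

lemma abs_sub_le_gridVariation (f : ℕ → ℝ) {T : ℝ≥0} {M N : ℕ} {x : ℝ≥0 → ℕ}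
    (hx : ∀ s ≤ T, x s < M) {i : ℕ} (hi : i ≤ N + 1) :
    |f (x (i * (T / (N + 1 : ℕ)))) - f (x 0)| ≤ gridVariation f T M N x := by
  have key : ∀ i ≤ N + 1, |f (x (i * (T / (N + 1 : ℕ)))) - f (x 0)| ≤ ∑ j ∈ Finset.range i,
      truncIncrement f M (x (j * (T / (N + 1 : ℕ))))
        (x (j * (T / (N + 1 : ℕ)) + T / (N + 1 : ℕ))) := by
    intro i
    induction i with
    | zero => simp
    | succ i ih =>
      intro hi
      have heq : ((i + 1 : ℕ) : ℝ≥0) * (T / (N + 1 : ℕ)) =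
          i * (T / (N + 1 : ℕ)) + T / (N + 1 : ℕ) := by
        push_cast
        ring
      have h2 := hx _ (grid_le hi)
      rw [heq] at h2 ⊢
      rw [Finset.sum_range_succ, truncIncrement, if_pos ⟨hx _ (grid_le (by omega)), h2⟩]
      exact (abs_sub_le _ _ _).trans ((add_comm _ _).trans_le
        (add_le_add (ih (by omega)) le_rfl))
  refine (key i hi).trans (Finset.sum_le_sum_of_subset_of_nonneg ?_ fun _ _ _ =>
    truncIncrement_nonneg _ _ _ _)
  exact Finset.range_mono hi

/-! ### The maximal increment along a path -/

section Path

variable {Ω : Type*} {X : ℝ≥0 → Ω → ℕ} {ω : Ω}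

lemma finite_incrementSet (hx : IsCadlagPath fun t => X t ω) (g : ℝ → ℝ) (T : ℝ≥0) :
    (incrementSet X g T ω).Finite := by
  have hK : ((fun t => X t ω) '' Set.Icc 0 T).Finite := hx.finite_image isCompact_Icc
  refine (hK.image fun k : ℕ => |g k - g (X 0 ω)|).subset ?_
  rintro _ ⟨s, hs, rfl⟩
  exact ⟨_, ⟨s, ⟨zero_le, by exact_mod_cast hs⟩, rfl⟩, rfl⟩

lemma isGreatest_maxIncrement (hx : IsCadlagPath fun t => X t ω) (g : ℝ → ℝ) (T : ℝ≥0) :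
    IsGreatest (incrementSet X g T ω) (maxIncrement X g T ω) := by
  have hne : (incrementSet X g T ω).Nonempty := ⟨_, 0, by simp, rfl⟩
  exact ⟨hne.csSup_mem (finite_incrementSet hx g T),
    fun y hy => le_csSup (finite_incrementSet hx g T).bddAbove hy⟩

/-- The maximal increment along the grid of mesh `T / (N + 1)`. -/
noncomputable def gridMax (X : ℝ≥0 → Ω → ℕ) (g : ℝ → ℝ) (T : ℝ≥0) (N : ℕ) (ω : Ω) : ℝ :=
  (Finset.range (N + 2)).sup' ⟨0, by simp⟩
    fun i => |g (X (i * (T / (N + 1 : ℕ))) ω) - g (X 0 ω)|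

lemma eventually_gridMax_eq (hx : IsCadlagPath fun t => X t ω) (g : ℝ → ℝ) {T : ℝ≥0}
    (hT : 0 < T) : ∀ᶠ N in atTop, gridMax X g T N ω = maxIncrement X g T ω := by
  obtain ⟨⟨s, hs, hsY⟩, hub⟩ := isGreatest_maxIncrement hx g T
  filter_upwards [eventually_exists_grid_eq hT (by exact_mod_cast hs) (hx.1 s)] with N hN
  obtain ⟨i, hi, hiX⟩ := hN
  refine le_antisymm (Finset.sup'_le _ _ fun j hj => hub ⟨_, ?_, rfl⟩) ?_
  · rw [Finset.mem_range] at hj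
    exact_mod_cast grid_le (T := T) (N := N) (i := j) (by omega)
  · rw [← hsY]
    refine le_trans (le_of_eq ?_) (Finset.le_sup' _ (Finset.mem_range.2 (Nat.lt_succ_of_le hi)))
    simp only [hiX]

lemma maxIncrement_le_iSup_liminf (hx : IsCadlagPath fun t => X t ω) (g : ℝ → ℝ) {T : ℝ≥0}
    (hT : 0 < T) :
    ENNReal.ofReal (maxIncrement X g T ω) ≤ ⨆ M, liminf (fun N =>
      ENNReal.ofReal (gridVariation (fun k => g k) T M N fun t => X t ω)) atTop := by
  obtain ⟨M, hM⟩ := (hx.finite_image (K := Set.Icc 0 T) isCompact_Icc).bddAbove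
  have hlt : ∀ s ≤ T, X s ω < M + 1 := fun s hs =>
    Nat.lt_succ_of_le (hM ⟨s, ⟨zero_le, hs⟩, rfl⟩)
  refine le_iSup_of_le (M + 1) (le_liminf_of_le (by isBoundedDefault) ?_)
  filter_upwards [eventually_gridMax_eq hx g hT] with N hN
  rw [← hN]
  refine ENNReal.ofReal_le_ofReal (Finset.sup'_le _ _ fun i hi => ?_)
  exact abs_sub_le_gridVariation (fun k : ℕ => g k) hlt
    (Nat.le_of_lt_succ (Finset.mem_range.1 hi))

lemma truncIncrement_eq_sum (f : ℕ → ℝ) (M : ℕ) (s t : ℝ≥0) :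
    truncIncrement f M (X s ω) (X t ω) = ∑ k ∈ Finset.range M, ∑ j ∈ Finset.range M,
      ({ω | X s ω = k} ∩ {ω | X t ω = j}).indicator (fun _ => |f j - f k|) ω := by
  classical
  simp only [Set.indicator_apply, mem_inter_iff, mem_ofPred_eq, ite_and]
  simp [truncIncrement, ite_and]

end Path

/-! ### Expected grid variation -/

section Expectation

variable {Ω : Type*} [MeasurableSpace Ω] {ν : Measure Ω}
  {lam mu : ℕ → ℝ} {P : ℝ≥0 → ℕ → ℕ → ℝ} {X : ℝ≥0 → Ω → ℕ}

lemma IsStationaryBirthDeathProcess.measureReal_eq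
    (hX : IsStationaryBirthDeathProcess ν lam mu P X) (s : ℝ≥0) (k : ℕ) :
    ν.real {ω | X s ω = k} = stationaryProb lam mu k := by
  have h := (hX.stationary {0} s).measure_mem_eq
    (s := {y | y ⟨0, by simp⟩ = k}) (measurableSet_eq_fun (measurable_pi_apply _) measurable_const)
  rw [← hX.initial k]
  simpa [Measure.real, Set.preimage] using congrArg ENNReal.toReal h

lemma IsStationaryBirthDeathProcess.measureReal_inter_eq
    (hX : IsStationaryBirthDeathProcess ν lam mu P X) (s h : ℝ≥0) (k j : ℕ) :
    ν.real ({ω | X s ω = k} ∩ {ω | X (s + h) ω = j}) = stationaryProb lam mu k * P h k j := by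
  have := hX.markov s h k j univ MeasurableSet.univ
  rwa [univ_inter, hX.measureReal_eq] at this

lemma IsStationaryBirthDeathProcess.aestronglyMeasurable_maxIncrement
    (hX : IsStationaryBirthDeathProcess ν lam mu P X) (g : ℝ → ℝ) {T : ℝ≥0} (hT : 0 < T) :
    AEStronglyMeasurable (maxIncrement X g T) ν := by
  refine aestronglyMeasurable_of_tendsto_ae atTop (f := gridMax X g T) (fun N => ?_) ?_
  · have : Measurable (gridMax X g T N) := by
      unfold gridMax
      refine Finset.measurable_range_sup'' fun i _ => ?_
      exact (Measurable.of_discrete (f := fun y : ℕ × ℕ => |g y.1 - g y.2|)).comp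
        ((hX.measurable _).prodMk (hX.measurable 0))
    exact this.aestronglyMeasurable
  · filter_upwards [hX.cadlag] with ω hω
    exact tendsto_const_nhds.congr' ((eventually_gridMax_eq hω g hT).mono fun N hN => hN.symm)

lemma measurable_truncIncrement (hX : ∀ t, Measurable (X t)) (f : ℕ → ℝ) (M : ℕ) (s t : ℝ≥0) :
    Measurable fun ω => truncIncrement f M (X s ω) (X t ω) :=
  (Measurable.of_discrete (f := fun y : ℕ × ℕ => truncIncrement f M y.1 y.2)).comp
    ((hX s).prodMk (hX t))

variable [IsProbabilityMeasure ν]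

lemma IsStationaryBirthDeathProcess.integrable_truncIncrement
    (hX : IsStationaryBirthDeathProcess ν lam mu P X) (f : ℕ → ℝ) (M : ℕ) (s t : ℝ≥0) :
    Integrable (fun ω => truncIncrement f M (X s ω) (X t ω)) ν := by
  simp_rw [truncIncrement_eq_sum]
  refine integrable_finsetSum _ fun k _ => integrable_finsetSum _ fun j _ =>
    (integrable_const _).indicator ?_
  exact (hX.measurable s (measurableSet_singleton k)).inter
    (hX.measurable t (measurableSet_singleton j))

lemma IsStationaryBirthDeathProcess.integral_truncIncrement
    (hX : IsStationaryBirthDeathProcess ν lam mu P X) (f : ℕ → ℝ) (M : ℕ) (s h : ℝ≥0) :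
    ∫ ω, truncIncrement f M (X s ω) (X (s + h) ω) ∂ν =
      ∑ k ∈ Finset.range M, ∑ j ∈ Finset.range M,
        stationaryProb lam mu k * P h k j * |f j - f k| := by
  have hm : ∀ k j : ℕ, MeasurableSet ({ω | X s ω = k} ∩ {ω | X (s + h) ω = j}) := fun k j =>
    (hX.measurable s (measurableSet_singleton k)).inter
      (hX.measurable (s + h) (measurableSet_singleton j))
  simp_rw [truncIncrement_eq_sum]
  rw [integral_finsetSum _ fun k _ => integrable_finsetSum _ fun j _ =>
    (integrable_const _).indicator (hm k j)]
  refine Finset.sum_congr rfl fun k _ => ?_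
  rw [integral_finsetSum _ fun j _ => (integrable_const _).indicator (hm k j)]
  refine Finset.sum_congr rfl fun j _ => ?_
  rw [integral_indicator_const _ (hm k j), hX.measureReal_inter_eq, smul_eq_mul]

lemma IsStationaryBirthDeathProcess.integrable_gridVariation
    (hX : IsStationaryBirthDeathProcess ν lam mu P X) (f : ℕ → ℝ) (T : ℝ≥0) (M N : ℕ) :
    Integrable (fun ω => gridVariation f T M N fun t => X t ω) ν :=
  integrable_finsetSum _ fun _ _ => hX.integrable_truncIncrement f M _ _

/-- As the mesh tends to `0`, the expected truncated variation converges to `T` times the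
stationary rate at which `f ∘ X` varies by jumps below the level `M`. Only finitely many states
are involved, so no uniformity in the `o(h)` terms is needed. -/
lemma IsStationaryBirthDeathProcess.tendsto_integral_gridVariation
    (hX : IsStationaryBirthDeathProcess ν lam mu P X) (hmu : mu 0 = 0) (f : ℕ → ℝ) {T : ℝ≥0}
    (hT : 0 < T) (M : ℕ) :
    Tendsto (fun N => ∫ ω, gridVariation f T M N (fun t => X t ω) ∂ν) atTop
      (𝓝 (T * ∑ k ∈ Finset.range M, ∑ j ∈ Finset.range M,
        stationaryProb lam mu k * jumpRate lam mu k j * |f j - f k|)) := by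
  have hlim : Tendsto (fun N : ℕ => T / ((N + 1 : ℕ) : ℝ≥0)) atTop (𝓝[>] 0) := by
    refine tendsto_nhdsWithin_iff.2 ⟨(tendsto_const_div_atTop_nhds_zero_nat T).comp
      (tendsto_add_atTop_nat 1), Eventually.of_forall fun N => ?_⟩
    exact div_pos hT (by positivity)
  have h1 : Tendsto (fun h : ℝ≥0 => (T : ℝ) * ∑ k ∈ Finset.range M, ∑ j ∈ Finset.range M,
      stationaryProb lam mu k * (P h k j / h) * |f j - f k|) (𝓝[>] 0)
      (𝓝 (T * ∑ k ∈ Finset.range M, ∑ j ∈ Finset.range M,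
        stationaryProb lam mu k * jumpRate lam mu k j * |f j - f k|)) := by
    refine Tendsto.const_mul _ (tendsto_finsetSum _ fun k _ => tendsto_finsetSum _ fun j _ => ?_)
    by_cases hkj : k = j
    · subst hkj
      simp
    · exact ((hX.transition.tendsto_div hmu hkj).const_mul _).mul_const _
  refine (h1.comp hlim).congr fun N => ?_
  unfold gridVariation
  rw [integral_finsetSum _ fun _ _ => hX.integrable_truncIncrement f M _ _]
  simp_rw [hX.integral_truncIncrement]
  rw [Finset.sum_const, Finset.card_range, nsmul_eq_mul, Function.comp_apply, Finset.mul_sum,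
    Finset.mul_sum]
  refine Finset.sum_congr rfl fun k _ => ?_
  rw [Finset.mul_sum, Finset.mul_sum]
  refine Finset.sum_congr rfl fun j _ => ?_
  have hT' : (T : ℝ) ≠ 0 := by exact_mod_cast hT.ne'
  push_cast
  have hN : (N : ℝ) + 1 ≠ 0 := by positivity
  field_simp

/-- If the stationary rate of variation of `g ∘ X` is at most `C` at every truncation level, then
the expected maximal increment over `[0, T]` is at most `C * T`, by Fatou's lemma and monotone
convergence in the truncation level. -/
lemma IsStationaryBirthDeathProcess.lintegral_maxIncrement_le
    (hX : IsStationaryBirthDeathProcess ν lam mu P X) (hmu : mu 0 = 0) (g : ℝ → ℝ) {T : ℝ≥0}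
    (hT : 0 < T) {C : ℝ}
    (hC : ∀ M, ∑ k ∈ Finset.range M, ∑ j ∈ Finset.range M,
      stationaryProb lam mu k * jumpRate lam mu k j * |g j - g k| ≤ C) :
    ∫⁻ ω, ENNReal.ofReal (maxIncrement X g T ω) ∂ν ≤ ENNReal.ofReal (C * T) := by
  have hmeas : ∀ M N, Measurable fun ω =>
      ENNReal.ofReal (gridVariation (fun k => g k) T M N fun t => X t ω) := fun M N =>
    (Finset.measurable_sum _ fun _ _ =>
      measurable_truncIncrement hX.measurable _ _ _ _).ennreal_ofReal
  calc ∫⁻ ω, ENNReal.ofReal (maxIncrement X g T ω) ∂ν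
      ≤ ∫⁻ ω, ⨆ M, liminf (fun N =>
          ENNReal.ofReal (gridVariation (fun k => g k) T M N fun t => X t ω)) atTop ∂ν :=
        lintegral_mono_ae (hX.cadlag.mono fun ω hω => maxIncrement_le_iSup_liminf hω g hT)
    _ = ⨆ M, ∫⁻ ω, liminf (fun N =>
          ENNReal.ofReal (gridVariation (fun k => g k) T M N fun t => X t ω)) atTop ∂ν := by
        refine lintegral_iSup (fun M => Measurable.liminf (hmeas M)) fun M M' h ω => ?_
        exact liminf_le_liminf (Eventually.of_forall fun N =>
          ENNReal.ofReal_le_ofReal (gridVariation_mono _ _ _ _ h))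
    _ ≤ ENNReal.ofReal (C * T) := by
        refine iSup_le fun M => (lintegral_liminf_le (hmeas M)).trans ?_
        have hint : ∀ N, ∫⁻ ω, ENNReal.ofReal
            (gridVariation (fun k => g k) T M N fun t => X t ω) ∂ν =
            ENNReal.ofReal (∫ ω, gridVariation (fun k => g k) T M N (fun t => X t ω) ∂ν) :=
          fun N => (ofReal_integral_eq_lintegral_ofReal (hX.integrable_gridVariation _ T M N)
            (Eventually.of_forall fun ω => gridVariation_nonneg _ _ _ _ _)).symm
        simp_rw [hint]
        rw [(ENNReal.tendsto_ofReal (hX.tendsto_integral_gridVariation hmu _ hT M)).liminf_eq]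
        refine ENNReal.ofReal_le_ofReal ?_
        rw [mul_comm]
        exact mul_le_mul_of_nonneg_right (hC M) T.2

lemma IsStationaryBirthDeathProcess.integrable_maxIncrement
    (hX : IsStationaryBirthDeathProcess ν lam mu P X) (hmu : mu 0 = 0) (g : ℝ → ℝ) {T : ℝ≥0}
    (hT : 0 < T) {C : ℝ} (hC0 : 0 ≤ C)
    (hC : ∀ M, ∑ k ∈ Finset.range M, ∑ j ∈ Finset.range M,
      stationaryProb lam mu k * jumpRate lam mu k j * |g j - g k| ≤ C) :
    Integrable (maxIncrement X g T) ν ∧ 0 ≤ ∫ ω, maxIncrement X g T ω ∂ν ∧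
      ∫ ω, maxIncrement X g T ω ∂ν ≤ C * T := by
  have hnn : ∀ ω, 0 ≤ maxIncrement X g T ω := fun ω =>
    Real.sSup_nonneg (by rintro _ ⟨s, -, rfl⟩; positivity)
  have hle := hX.lintegral_maxIncrement_le hmu g hT hC
  have hm := hX.aestronglyMeasurable_maxIncrement g hT
  refine ⟨⟨hm, ?_⟩, integral_nonneg hnn, ?_⟩
  · rw [hasFiniteIntegral_iff_ofReal (Eventually.of_forall hnn)]
    exact hle.trans_lt ENNReal.ofReal_lt_top
  · rw [integral_eq_lintegral_of_nonneg_ae (Eventually.of_forall hnn) hm]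
    exact ENNReal.toReal_le_of_le_ofReal (mul_nonneg hC0 T.2) hle

end Expectation

/-! ### The exponential function -/

lemma potentialCoeff_nonneg {lam mu : ℕ → ℝ} (h : IsBirthDeathRates lam mu) (k : ℕ) :
    0 ≤ potentialCoeff lam mu k :=
  Finset.prod_nonneg fun i _ => div_nonneg (h.birth_pos i).le (h.death_pos _ (by omega)).le

lemma stationaryProb_nonneg {lam mu : ℕ → ℝ} (h : IsBirthDeathRates lam mu) (k : ℕ) :
    0 ≤ stationaryProb lam mu k :=
  div_nonneg (potentialCoeff_nonneg h k) (tsum_nonneg (potentialCoeff_nonneg h))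

lemma IsBirthDeathRates.death_nonneg {lam mu : ℕ → ℝ} (h : IsBirthDeathRates lam mu) (k : ℕ) :
    0 ≤ mu k := by
  rcases Nat.eq_zero_or_pos k with rfl | hk
  · exact h.death_zero.ge
  · exact (h.death_pos k hk).le

lemma sum_jumpRate_mul_le {lam mu : ℕ → ℝ} (h : IsBirthDeathRates lam mu) {u : ℕ → ℝ}
    {k : ℕ} {B : ℝ} (hB : ∀ j, j = k + 1 ∨ j + 1 = k → u j ≤ B) (hB0 : 0 ≤ B) (M : ℕ) :
    ∑ j ∈ Finset.range M, jumpRate lam mu k j * u j ≤ (lam k + mu k) * B := by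
  have h1 : ∀ j, jumpRate lam mu k j * u j ≤
      (if j = k + 1 then lam k * B else 0) + (if j = k - 1 then mu k * B else 0) := by
    intro j
    have hl := (h.birth_pos k).le
    have hm := h.death_nonneg k
    have hlB := mul_nonneg hl hB0
    have hmB := mul_nonneg hm hB0
    unfold jumpRate
    by_cases hj : j = k + 1
    · have := mul_le_mul_of_nonneg_left (hB j (Or.inl hj)) hl
      rw [if_pos hj, if_pos hj]
      split_ifs <;> linarith
    · by_cases hj2 : j + 1 = k
      · have := mul_le_mul_of_nonneg_left (hB j (Or.inr hj2)) hm
        rw [if_neg hj, if_neg hj, if_pos hj2, if_pos (by omega)]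
        linarith
      · rw [if_neg hj, if_neg hj, if_neg hj2]
        split_ifs <;> linarith
  refine (Finset.sum_le_sum fun j _ => h1 j).trans ?_
  have hlB := mul_nonneg (h.birth_pos k).le hB0
  have hmB := mul_nonneg (h.death_nonneg k) hB0
  rw [Finset.sum_add_distrib, Finset.sum_ite_eq', Finset.sum_ite_eq']
  split_ifs <;> linarith

lemma abs_exp_sub_exp_le (q c : ℝ) {k j : ℕ} (h : j = k + 1 ∨ j + 1 = k) :
    |Real.exp (q * (j - c)) - Real.exp (q * (k - c))| ≤
      Real.exp (-(q * c)) * (Real.exp |q| + 1) * Real.exp (q * k) := by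
  have hb : ∀ y : ℝ, y ≤ |q| → |Real.exp y - 1| ≤ Real.exp |q| + 1 := fun y hy => by
    have h1 := Real.exp_le_exp.2 hy
    have h2 := Real.exp_pos y
    rw [abs_le]
    constructor <;> linarith
  obtain ⟨y, hy, hj⟩ : ∃ y ≤ |q|, q * (j - c) = q * (k - c) + y := by
    rcases h with rfl | rfl
    · exact ⟨q, le_abs_self q, by push_cast; ring⟩
    · exact ⟨-q, neg_le_abs q, by push_cast; ring⟩
  calc |Real.exp (q * (j - c)) - Real.exp (q * (k - c))|
      = Real.exp (q * (k - c)) * |Real.exp y - 1| := by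
        rw [hj, Real.exp_add, ← mul_sub_one, abs_mul, abs_of_pos (Real.exp_pos _)]
    _ ≤ Real.exp (q * (k - c)) * (Real.exp |q| + 1) :=
        mul_le_mul_of_nonneg_left (hb y hy) (Real.exp_pos _).le
    _ = Real.exp (-(q * c)) * (Real.exp |q| + 1) * Real.exp (q * k) := by
        rw [show q * ((k : ℝ) - c) = -(q * c) + q * k by ring, Real.exp_add]
        ring

/-- The stationary rate of variation of `exp (q (X - c))` is finite. -/
lemma exists_variationRate_le {lam mu : ℕ → ℝ} (h : IsBirthDeathRates lam mu) (q c : ℝ)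
    (hS : Summable fun k : ℕ => potentialCoeff lam mu k * (Real.exp (q * k) * (lam k + mu k))) :
    ∃ C, 0 ≤ C ∧ ∀ M, ∑ k ∈ Finset.range M, ∑ j ∈ Finset.range M,
      stationaryProb lam mu k * jumpRate lam mu k j *
        |Real.exp (q * (j - c)) - Real.exp (q * (k - c))| ≤ C := by
  set D := Real.exp (-(q * c)) * (Real.exp |q| + 1) with hD
  have hD0 : 0 ≤ D := by positivity
  set a : ℕ → ℝ := fun k =>
    stationaryProb lam mu k * ((lam k + mu k) * (D * Real.exp (q * k))) with ha
  have ha0 : ∀ k, 0 ≤ a k := fun k => by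
    have := stationaryProb_nonneg h k
    have := h.birth_pos k
    have := h.death_nonneg k
    simp only [ha]
    positivity
  have hsum : Summable a := by
    refine (hS.mul_left (D / ∑' j, potentialCoeff lam mu j)).congr fun k => ?_
    simp only [ha, stationaryProb]
    ring
  refine ⟨∑' k, a k, tsum_nonneg ha0, fun M => le_trans (Finset.sum_le_sum fun k _ => ?_)
    (hsum.sum_le_tsum (Finset.range M) fun k _ => ha0 k)⟩
  simp_rw [mul_assoc]
  rw [← Finset.mul_sum]
  exact mul_le_mul_of_nonneg_left (sum_jumpRate_mul_le h (fun j hj => abs_exp_sub_exp_le q c hj)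
    (by positivity) M) (stationaryProb_nonneg h k)

theorem proposition1 {Ω : Type*} [MeasurableSpace Ω] (ν : Measure Ω) [IsProbabilityMeasure ν]
    (lam mu : ℕ → ℝ) (P : ℝ≥0 → ℕ → ℕ → ℝ) (X : ℝ≥0 → Ω → ℕ)
    (hrates : IsBirthDeathRates lam mu)
    (hergodic : IsErgodicRates lam mu)
    (hX : IsStationaryBirthDeathProcess ν lam mu P X)
    (δ : ℝ) (hδ : 0 < δ) (herror : HasErrorGrowth lam mu P δ)
    (q : ℝ)
    (hS : Summable (fun k : ℕ => potentialCoeff lam mu k *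
      (Real.exp (q * k) * (lam k + mu k) + (k : ℝ) ^ δ)))
    (c : ℝ) (g : ℝ → ℝ) (hg : g = fun x => Real.exp (q * (x - c)))
    (b : ℝ) (hb : 1 < b) :
    (∀ n : ℕ, ∀ᵐ ω ∂ν, IsGreatest (incrementSet X g (b ^ (-(n : ℤ))) ω)
      (maxIncrement X g (b ^ (-(n : ℤ))) ω)) ∧
    (∀ n : ℕ, Integrable (maxIncrement X g (b ^ (-(n : ℤ)))) ν) ∧
    Summable (fun n : ℕ => ∫ ω, maxIncrement X g (b ^ (-(n : ℤ))) ω ∂ν) := by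

  obtain ⟨C, hC0, hC⟩ := exists_variationRate_le hrates q c <| by
    refine Summable.of_nonneg_of_le (fun k => ?_) (fun k => ?_) hS
    · have := potentialCoeff_nonneg hrates k
      have := hrates.birth_pos k
      have := hrates.death_nonneg k
      positivity
    · refine mul_le_mul_of_nonneg_left ?_ (potentialCoeff_nonneg hrates k)
      have : (0 : ℝ) ≤ (k : ℝ) ^ δ := by positivity
      linarith
  have hb0 : 0 < b := by linarith
  -- `T n` is `b ^ (-n)` as a nonnegative real.
  obtain ⟨T, hT⟩ : ∃ T : ℕ → ℝ≥0, ∀ n : ℕ, b ^ (-(n : ℤ)) = T n :=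
    ⟨fun n => ⟨b ^ (-(n : ℤ)), by positivity⟩, fun n => rfl⟩
  have hT0 : ∀ n, 0 < T n := fun n => by
    have : 0 < b ^ (-(n : ℤ)) := by positivity
    rw [hT n] at this
    exact_mod_cast this
  have key := fun n => hX.integrable_maxIncrement hrates.death_zero g (hT0 n) hC0
    (by simpa only [hg] using hC)
  simp_rw [hT]
  refine ⟨fun n => hX.cadlag.mono fun ω hω => isGreatest_maxIncrement hω g (T n),
    fun n => (key n).1, ?_⟩
  refine Summable.of_nonneg_of_le (fun n => (key n).2.1) (fun n => (key n).2.2)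
    (Summable.mul_left C ?_)
  simp_rw [← hT, zpow_neg, zpow_natCast, ← inv_pow]
  exact summable_geometric_of_lt_one (by positivity) (inv_lt_one_of_one_lt₀ hb)
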